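/- Let $t=(t^{(1)},t^{(2)},t^{(3)})$ with $t^{(i)}=(t^{(i)}_k)_{k\ge1}$, and let $\widetilde\tau_{\bm m}\in\mathbb C[[t]]$, $\bm m=(m_1,m_2)\in\mathbb Z^2$, be a family of nonzero formal power series. Put $\bm e_1=(1,0)$, $\bm e_2=(0,1)$, $\bm e=(1,1)$, $\xi(t^{(i)},z)=\sum_{k\ge1}t^{(i)}_kz^k$, and let $t\pm[w]_i$ be obtained from $t$ by replacing $t^{(i)}_k$ with $t^{(i)}_k\pm w^k/k$ for all $k\geq 1$. Define the wave functions and adjoint wave functions \begin{align*} &\Psi_1(\bm m,t,z)=z^{m_1}e^{\xi(t^{(1)},z)}\frac{\widetilde\tau_{\bm m}(t-[z^{-1}]_1)}{\widetilde\tau_{\bm m}(t)},&& \widetilde\Psi_1(\bm m,t,z)=z^{-m_1+1}e^{-\xi(t^{(1)},z)}\frac{\widetilde\tau_{\bm m}(t+[z^{-1}]_1)}{\widetilde\tau_{\bm m}(t)},\\ &\Psi_2(\bm m,t,z)=z^{m_2}e^{\xi(t^{(2)},z^{-1})}\frac{\widetilde\tau_{\bm m+\bm e}(t-[z]_2)}{\widetilde\tau_{\bm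 m}(t)},&& \widetilde\Psi_2(\bm m,t,z)=z^{-m_2+1}e^{-\xi(t^{(2)},z^{-1})}\frac{\widetilde\tau_{\bm m-\bm e}(t+[z]_2)}{\widetilde\tau_{\bm m}(t)},\\ &\Psi_3(\bm m,t,z)=(-1)^{m_2}z^{m_1-m_2}e^{\xi(t^{(3)},z^{-1})}\frac{\widetilde\tau_{\bm m+\bm e_1}(t-[z]_3)}{\widetilde\tau_{\bm m}(t)},&& \widetilde\Psi_3(\bm m,t,z)=(-1)^{m_2}z^{-m_1+m_2+1}e^{-\xi(t^{(3)},z^{-1})}\frac{\widetilde\tau_{\bm m-\bm e_1}(t+[z]_3)}{\widetilde\tau_{\bm m}(t)}, \end{align*} as formal series in $z$, infinite in both directions, with coefficients in the fraction field $K$ of $\mathbb C[[t]]$: the factors $\widetilde\tau(t\pm[z^{-1}]_1)$ are expanded in powers of $z^{-1}$, and the factors $\widetilde\tau(t\pm[z]_2)$, $\widetilde\tau(t\pm[z]_3)$ in powers of $z$. Correspondingly, $\oint_{C_R}\frac{dz}{2\pi iz}$ (circle at $z=\infty$) and $\oint_{C_r}\frac{dz}{2\pi iz}$ (circle at $z=0$)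 both mean taking the coefficient of $z^0$. Let $\mathcal B$ be the ring of functions $a(\bm m)=a(\bm m,t)$ from $\mathbb Z^2$ to $K$, let $\Lambda_1,\Lambda_2$ be the shift operators $\Lambda_i(f(\bm m))=f(\bm m+\bm e_i)$, and let $\mathcal E=\mathcal B[\Lambda_1,\Lambda_1^{-1},\Lambda_2,\Lambda_2^{-1}]$ be the ring of finite sums $\sum_{j_1,j_2}a_{j_1,j_2}(\bm m)\Lambda_1^{j_1}\Lambda_2^{j_2}$, which acts on functions of $(\bm m,t,z)$. Let $n_1,n_2,n_3\ge0$ be integers. Then the bilinear equations of the $[n_1,n_2,n_3]$-KdV hierarchy \[ \oint_{C_R}\frac{dz}{2\pi iz}z^{n_1l}\Psi_1(\bm m,t,z)\widetilde\Psi_1(\bm m',t',z) =\oint_{C_r}\frac{dz}{2\pi iz}\Bigl(z^{-n_2l}\Psi_2(\bm m,t,z)\widetilde\Psi_2(\bm m',t',z)+z^{-n_3l}\Psi_3(\bm m,t,z)\widetilde\Psi_3(\bm m',t',z)\Bigr) \] for all integers $l\ge0$, all $\bm m,\bm m'\in\mathbb Z^2$ and independent $t,t'$, hold if and only if both of the following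 hold: \begin{itemize} \item the 3-KP bilinear equation, i.e. the case $l=0$ of the above for all $\bm m,\bm m',t,t'$; \item there exists $\mathfrak L\in\mathcal E$ such that $\mathfrak L(\Psi_1)=z^{n_1}\Psi_1$, $\mathfrak L(\Psi_2)=z^{-n_2}\Psi_2$ and $\mathfrak L(\Psi_3)=z^{-n_3}\Psi_3$. \end{itemize} -/

import Mathlib

noncomputable section

namespace KP3

/-! ### Time variables and functions of the times -/

/-- Index set of the time variables: `(i, k)` stands for the variable `t^{(i+1)}_k`, `k ≥ 1`. -/
abbrev Times := Fin 3 × ℕ+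

/-- Formal functions of `t = (t^{(1)}, t^{(2)}, t^{(3)})`: the power series ring `ℂ⟦t⟧`. -/
abbrev TimeSeries := MvPowerSeries Times ℂ

/-- Formal functions of two independent sets of times `t` (left) and `t'` (right). -/
abbrev TimeSeries₂ := MvPowerSeries (Times ⊕ Times) ℂ

instance (σ : Type) : IsDomain (MvPowerSeries σ ℂ) := NoZeroDivisors.to_isDomain _

/-- The field of quotients of formal power series in the variables `σ`. -/
def SeriesField (σ : Type) : Type := FractionRing (MvPowerSeries σ ℂ)

instance (σ : Type) : Field (SeriesField σ) :=
  inferInstanceAs (Field (FractionRing (MvPowerSeries σ ℂ)))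

instance (σ : Type) : Algebra (MvPowerSeries σ ℂ) (SeriesField σ) :=
  inferInstanceAs (Algebra (MvPowerSeries σ ℂ) (FractionRing (MvPowerSeries σ ℂ)))

instance (σ : Type) : IsFractionRing (MvPowerSeries σ ℂ) (SeriesField σ) :=
  inferInstanceAs (IsFractionRing (MvPowerSeries σ ℂ) (FractionRing (MvPowerSeries σ ℂ)))

/-- Quotients of formal functions of `t`. -/
abbrev TimeField := SeriesField Times

/-- Quotients of formal functions of `t` and `t'`. -/
abbrev TimeField₂ := SeriesField (Times ⊕ Times)

/-- `f ↦ f(t)`. -/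
def atT : TimeSeries →ₐ[ℂ] TimeSeries₂ :=
  MvPowerSeries.rename (Function.Embedding.inl : Times ↪ Times ⊕ Times)

/-- `f ↦ f(t')`. -/
def atT' : TimeSeries →ₐ[ℂ] TimeSeries₂ :=
  MvPowerSeries.rename (Function.Embedding.inr : Times ↪ Times ⊕ Times)

/-! ### Formal series in `z`, infinite in both directions -/

/-- A formal series `∑_{n ∈ ℤ} f n zⁿ` whose coefficients are power series in the variables `σ`. -/
abbrev ZSeries (σ : Type) := ℤ → MvPowerSeries σ ℂ

/-- The sum of a locally finite family of power series: the coefficient of each monomial is the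
sum of the (finitely many nonzero) coefficients of that monomial in the members of the family. -/
def locSum {σ : Type} (f : ℤ → MvPowerSeries σ ℂ) : MvPowerSeries σ ℂ :=
  fun d => ∑ᶠ k : ℤ, MvPowerSeries.coeff d (f k)

theorem coeff_locSum {σ : Type} (f : ℤ → MvPowerSeries σ ℂ) (d : σ →₀ ℕ) :
    MvPowerSeries.coeff d (locSum f) = ∑ᶠ k : ℤ, MvPowerSeries.coeff d (f k) := rfl

/-- The product of two formal series in `z`. -/
def zProd {σ : Type} (f g : ZSeries σ) : ZSeries σ :=
  fun n => locSum fun k => f k * g (n - k)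

/-- The series `z^p f`. -/
def zShift {σ : Type} (p : ℤ) (f : ZSeries σ) : ZSeries σ := fun n => f (n - p)

/-- `p(z)` for a power series `p`. -/
def inZ {σ : Type} (p : PowerSeries (MvPowerSeries σ ℂ)) : ZSeries σ :=
  fun n => if 0 ≤ n then PowerSeries.coeff n.toNat p else 0

/-- `p(z⁻¹)` for a power series `p`. -/
def inZInv {σ : Type} (p : PowerSeries (MvPowerSeries σ ℂ)) : ZSeries σ :=
  fun n => inZ p (-n)

/-- `ξ(t^{(i)}, w) = ∑_{k ≥ 1} t^{(i)}_k w^k`. -/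
def xi (i : Fin 3) : PowerSeries TimeSeries :=
  PowerSeries.mk fun k => if h : 0 < k then MvPowerSeries.X (i, ⟨k, h⟩) else 0

theorem hasSubst_smul_xi (i : Fin 3) (c : ℂ) : PowerSeries.HasSubst (c • xi i) :=
  PowerSeries.HasSubst.of_constantCoeff_zero' (by
    rw [← PowerSeries.coeff_zero_eq_constantCoeff_apply]
    simp [xi])

/-- `exp(c ξ(t^{(i)}, w))`, as a power series in `w`. -/
def expXi (i : Fin 3) (c : ℂ) : PowerSeries TimeSeries :=
  (PowerSeries.exp ℂ).subst (c • xi i)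

/-- The point `t + c [w]_i`, where `[w] = (w, w²/2, w³/3, …)` is added to `t^{(i)}`; the extra
variable `Sum.inr ()` is `w`. -/
def shiftedTimes (i : Fin 3) (c : ℂ) (s : Times) : MvPowerSeries (Times ⊕ Unit) ℂ :=
  MvPowerSeries.X (Sum.inl s) +
    if s.1 = i then (c / (s.2 : ℕ) : ℂ) • MvPowerSeries.X (Sum.inr ()) ^ (s.2 : ℕ) else 0

theorem hasSubst_shiftedTimes (i : Fin 3) (c : ℂ) :
    MvPowerSeries.HasSubst (shiftedTimes i c) where
  const_coeff s := by
    have h : (MvPowerSeries.constantCoeff (shiftedTimes i c s)) = 0 := by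
      unfold shiftedTimes
      split_ifs <;> simp [MvPowerSeries.smul_eq_C_mul]
    rw [h]
    exact IsNilpotent.zero
  coeff_zero d := by
    classical
    refine ((d.support.finite_toSet.preimage Sum.inl_injective.injOn).union
      (Set.finite_singleton (i, Nat.toPNat' (d (Sum.inr ()))))).subset ?_
    intro s hs
    by_contra hns
    rw [Set.mem_union, not_or] at hns
    obtain ⟨h1, h2⟩ := hns
    apply hs
    have e1 : d ≠ Finsupp.single (Sum.inl s) 1 := by
      rintro rfl
      exact h1 (by simp)
    unfold shiftedTimes
    rw [map_add, MvPowerSeries.coeff_X, if_neg e1, zero_add]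
    split_ifs with hi
    · have e2 : d ≠ Finsupp.single (Sum.inr ()) (s.2 : ℕ) := by
        rintro rfl
        exact h2 (by simp [← hi])
      rw [MvPowerSeries.coeff_smul, MvPowerSeries.coeff_X_pow, if_neg e2, mul_zero]
    · simp

/-- The coefficient of `wⁿ` in a power series in `t` and `w`. -/
def wCoeff (n : ℕ) (f : MvPowerSeries (Times ⊕ Unit) ℂ) : TimeSeries :=
  fun d => MvPowerSeries.coeff (Finsupp.sumElim d (Finsupp.single () n)) f

theorem coeff_wCoeff (n : ℕ) (f : MvPowerSeries (Times ⊕ Unit) ℂ) (d : Times →₀ ℕ) :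
    MvPowerSeries.coeff d (wCoeff n f) =
      MvPowerSeries.coeff (Finsupp.sumElim d (Finsupp.single () n)) f := rfl

/-- `f(t + c [w]_i)`, as a power series in `w` with coefficients in `ℂ⟦t⟧`. -/
def shiftSeries (i : Fin 3) (c : ℂ) (f : TimeSeries) : PowerSeries TimeSeries :=
  PowerSeries.mk fun n => wCoeff n (MvPowerSeries.subst (shiftedTimes i c) f)

/-! ### Wave functions -/

/-- A formal series `(∑_{n ∈ ℤ} num n zⁿ) / den` with a common denominator. -/
structure Wave where
  num : ZSeries Times
  den : TimeSeries

/-- The coefficient of `zⁿ`. -/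
def Wave.coeff (f : Wave) (n : ℤ) : TimeField :=
  algebraMap TimeSeries TimeField (f.num n) / algebraMap TimeSeries TimeField f.den

/-- The product `z^p f`. -/
def Wave.zMul (p : ℤ) (f : Wave) : Wave := ⟨zShift p f.num, f.den⟩

/-- `∮ dz/(2πiz) f(t, z) g(t', z)`: the coefficient of `z⁰` in the product. -/
def contour (f g : Wave) : TimeField₂ :=
  algebraMap TimeSeries₂ TimeField₂
      (zProd (fun n => atT (f.num n)) (fun n => atT' (g.num n)) 0) /
    (algebraMap TimeSeries₂ TimeField₂ (atT f.den) *
      algebraMap TimeSeries₂ TimeField₂ (atT' g.den))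

/-- The lattice of the discrete variables `m = (m₁, m₂)`. -/
abbrev Lattice := ℤ × ℤ

section

variable (τ : Lattice → TimeSeries) (m : Lattice)

/-- `Ψ₁ = z^{m₁} e^{ξ(t⁽¹⁾,z)} τ_m(t - [z⁻¹]₁) / τ_m(t)`. -/
def Psi1 : Wave where
  num := zShift m.1 (zProd (inZ (expXi 0 1)) (inZInv (shiftSeries 0 (-1) (τ m))))
  den := τ m

/-- `Ψ̃₁ = z^{-m₁+1} e^{-ξ(t⁽¹⁾,z)} τ_m(t + [z⁻¹]₁) / τ_m(t)`. -/
def adjPsi1 : Wave where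
  num := zShift (-m.1 + 1) (zProd (inZ (expXi 0 (-1))) (inZInv (shiftSeries 0 1 (τ m))))
  den := τ m

/-- `Ψ₂ = z^{m₂} e^{ξ(t⁽²⁾,z⁻¹)} τ_{m+(1,1)}(t - [z]₂) / τ_m(t)`. -/
def Psi2 : Wave where
  num := zShift m.2 (zProd (inZInv (expXi 1 1)) (inZ (shiftSeries 1 (-1) (τ (m + (1, 1))))))
  den := τ m

/-- `Ψ̃₂ = z^{-m₂+1} e^{-ξ(t⁽²⁾,z⁻¹)} τ_{m-(1,1)}(t + [z]₂) / τ_m(t)`. -/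
def adjPsi2 : Wave where
  num := zShift (-m.2 + 1)
    (zProd (inZInv (expXi 1 (-1))) (inZ (shiftSeries 1 1 (τ (m - (1, 1))))))
  den := τ m

/-- `Ψ₃ = (-1)^{m₂} z^{m₁-m₂} e^{ξ(t⁽³⁾,z⁻¹)} τ_{m+(1,0)}(t - [z]₃) / τ_m(t)`. -/
def Psi3 : Wave where
  num := fun n => ((-1 : ℂ) ^ m.2) • zShift (m.1 - m.2)
    (zProd (inZInv (expXi 2 1)) (inZ (shiftSeries 2 (-1) (τ (m + (1, 0)))))) n
  den := τ m

/-- `Ψ̃₃ = (-1)^{m₂} z^{-m₁+m₂+1} e^{-ξ(t⁽³⁾,z⁻¹)} τ_{m-(1,0)}(t + [z]₃) / τ_m(t)`. -/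
def adjPsi3 : Wave where
  num := fun n => ((-1 : ℂ) ^ m.2) • zShift (-m.1 + m.2 + 1)
    (zProd (inZInv (expXi 2 (-1))) (inZ (shiftSeries 2 1 (τ (m - (1, 0)))))) n
  den := τ m

end

/-! ### Bilinear equations -/

/-- The bilinear equations of the `[n₁,n₂,n₃]`-KdV hierarchy, for all `l ≥ 0`. -/
def KdVBilinear (n₁ n₂ n₃ : ℕ) (τ : Lattice → TimeSeries) : Prop :=
  ∀ (l : ℕ) (m m' : Lattice),
    contour ((Psi1 τ m).zMul (n₁ * l)) (adjPsi1 τ m') =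
      contour ((Psi2 τ m).zMul (-(n₂ * l))) (adjPsi2 τ m') +
        contour ((Psi3 τ m).zMul (-(n₃ * l))) (adjPsi3 τ m')

/-- The bilinear equation of the 3-KP hierarchy. -/
def KPBilinear (τ : Lattice → TimeSeries) : Prop :=
  ∀ m m' : Lattice,
    contour (Psi1 τ m) (adjPsi1 τ m') =
      contour (Psi2 τ m) (adjPsi2 τ m') + contour (Psi3 τ m) (adjPsi3 τ m')

/-! ### The ring of difference operators -/

/-- The ring `𝓑` of functions of `m` and `t`. -/
def CoeffRing : Type := Lattice → TimeField

instance : CommRing CoeffRing := inferInstanceAs (CommRing (Lattice → TimeField))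

/-- The lattice acts on `𝓑` by shifts: `(j • a)(m) = a(m + j)`. -/
instance : MulSemiringAction (Multiplicative Lattice) CoeffRing where
  smul j a := fun m => a (m + j.toAdd)
  one_smul a := funext fun m => congrArg a (add_zero m)
  mul_smul i j a := funext fun m => congrArg a (add_assoc m i.toAdd j.toAdd).symm
  smul_zero _ := rfl
  smul_add _ _ _ := rfl
  smul_one _ := rfl
  smul_mul _ _ _ := rfl

/-- The ring `𝓔 = 𝓑[Λ₁, Λ₁⁻¹, Λ₂, Λ₂⁻¹]` of Laurent polynomials `∑ a_{j₁,j₂} Λ₁^{j₁} Λ₂^{j₂}` in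
the shift operators, with `Λ₁^{j₁} Λ₂^{j₂} · a(m) = a(m + j) Λ₁^{j₁} Λ₂^{j₂}`. -/
abbrev DiffOp := SkewMonoidAlgebra CoeffRing (Multiplicative Lattice)

/-- The action of `∑ a_j Λ^j` on functions of `m` and `t` with parameter `z` (given by the
coefficients of the powers of `z`): `f ↦ ∑ a_j(m) f(m + j)`. -/
def DiffOp.act (A : DiffOp) (f : Lattice → ℤ → TimeField) : Lattice → ℤ → TimeField :=
  fun m n => A.coeff.sum fun j a => a m * f (m + j.toAdd) n

end KP3

end

/-!
Write the wave functions as series in a local parameter `w`, with `w = z⁻¹` for `Ψ₁` and `w = z`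
for `Ψ₂` and `Ψ₃`. The bilinear equations then say that the triples `z^{n l} Ψ(m)`, by which we mean
`(z^{n₁ l} Ψ₁, z^{-n₂ l} Ψ₂, z^{-n₃ l} Ψ₃)`, pair to zero with all adjoint triples `Ψ̃(m')`. Such
triples form a `ℂ⟦t⟧`-module `W` from which nonzero factors `a(t)` can be cancelled.

If `𝔏` exists, then clearing denominators makes a multiple of `z^n Ψ(m)` a combination of triples
`Ψ(m + j)`, and induction on `l` gives `z^{n l} Ψ(m) ∈ W`. Conversely, subtracting from a multiple
of `z^n Ψ(m)` a combination of the triples `Ψ(m + (n₁ - j, -n₂))`, `0 ≤ j ≤ n₁ + n₂ + n₃`, gives a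
triple in `W` whose components are exponentials times series `u i` in `w`; the cancellation in the
first component raises its order until the three orders have a positive sum. At `t' = t` the
exponentials disappear, and for each `i` there is an `m'` for which only the `i`-th residue
survives, being the product of the leading coefficients of `u i` and of the adjoint series. Hence
`u = 0`, which is the relation `𝔏 Ψ = z^n Ψ` with cleared denominators.
-/

noncomputable section

namespace KP3

open MvPowerSeries

section LocalSeries

variable {σ ρ : Type}

theorem support_coeff_mul_coeff_subset {R : Type*} [Semiring R] (x y : LaurentSeries R) (n : ℤ) :
    (Function.support fun k => x.coeff k * y.coeff (n - k)) ⊆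
      ((Finset.antidiagonal x.isPWO_support y.isPWO_support n).image Prod.fst : Finset ℤ) :=
  fun k hk => Finset.mem_coe.2 <| Finset.mem_image.2 ⟨(k, n - k), Finset.mem_antidiagonal.2
    ⟨left_ne_zero_of_mul hk, right_ne_zero_of_mul hk, add_sub_cancel k n⟩, rfl⟩

theorem hasFiniteSupport_coeff_mul_coeff {R : Type*} [Semiring R] (x y : LaurentSeries R) (n : ℤ) :
    Function.HasFiniteSupport fun k => x.coeff k * y.coeff (n - k) :=
  (Finset.finite_toSet _).subset (support_coeff_mul_coeff_subset x y n)

theorem coeff_mul_eq_finsum {R : Type*} [Semiring R] (x y : LaurentSeries R) (n : ℤ) :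
    (x * y).coeff n = ∑ᶠ k, x.coeff k * y.coeff (n - k) := by
  rw [HahnSeries.coeff_mul, finsum_eq_sum_of_support_subset _
    (support_coeff_mul_coeff_subset x y n), Finset.sum_image]
  · refine Finset.sum_congr rfl fun p hp => ?_
    rw [← (Finset.mem_antidiagonal.1 hp).2.2, add_sub_cancel_left]
  · intro p hp q hq h
    simp only [Finset.mem_coe, Finset.mem_antidiagonal] at hp hq
    exact Prod.ext h (by omega)

theorem locSum_eq_finsum {f : ℤ → MvPowerSeries σ ℂ} (hf : f.HasFiniteSupport) :
    locSum f = ∑ᶠ k, f k := by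
  ext d
  rw [coeff_locSum, map_finsum (coeff d) hf]

theorem locSum_comp_equiv (e : ℤ ≃ ℤ) (f : ℤ → MvPowerSeries σ ℂ) :
    locSum (fun k => f (e k)) = locSum f := by
  ext d
  exact finsum_comp_equiv e (f := fun k => coeff d (f k))

/-- Power series in the variables `σ` whose coefficients are Laurent series in a local parameter
`w`. Formal series in `z = w^{±1}` such as `e^{ξ(t,z)}` are infinite in both directions, but each
monomial in `t` meets only finitely many negative powers of `w`; collecting the monomials first
therefore turns them into elements of this honest commutative ring. -/
abbrev LocalSeries (σ : Type) := MvPowerSeries σ (LaurentSeries ℂ)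

/-- The coefficient of `wⁿ`, a power series in the variables `σ`. -/
def paramCoeff (n : ℤ) : LocalSeries σ →ₗ[MvPowerSeries σ ℂ] MvPowerSeries σ ℂ where
  toFun F := fun d => (coeff d F).coeff n
  map_add' _ _ := rfl
  map_smul' a F := by
    classical
    ext d
    refine Eq.trans ?_ (coeff_mul (R := ℂ) d a _).symm
    change (coeff d (a • F)).coeff n = _
    rw [Algebra.smul_def, coeff_mul, HahnSeries.coeff_sum]
    refine Finset.sum_congr rfl fun p _ => ?_
    rw [algebraMap_apply'', coeff_map, HahnSeries.algebraMap_apply', PowerSeries.algebraMap_apply,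
      Algebra.algebraMap_self_apply, HahnSeries.ofPowerSeries_C, HahnSeries.C_mul_eq_smul]
    rfl

theorem coeff_paramCoeff (n : ℤ) (F : LocalSeries σ) (d : σ →₀ ℕ) :
    coeff d (paramCoeff n F) = (coeff d F).coeff n := rfl

theorem ext_paramCoeff {F G : LocalSeries σ}
    (h : ∀ n, paramCoeff n F = paramCoeff n G) : F = G := by
  ext d n
  exact congrArg (coeff d) (h n)

theorem paramCoeff_mul (F G : LocalSeries σ) (n : ℤ) :
    paramCoeff n (F * G) = zProd (fun k => paramCoeff k F) (fun k => paramCoeff k G) n := by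
  classical
  ext d
  unfold zProd
  rw [coeff_paramCoeff, coeff_locSum, coeff_mul, HahnSeries.coeff_sum]
  simp only [coeff_mul, coeff_paramCoeff, coeff_mul_eq_finsum]
  exact (finsum_sum_comm _
    (fun k (p : (σ →₀ ℕ) × (σ →₀ ℕ)) => (coeff p.1 F).coeff k * (coeff p.2 G).coeff (n - k))
    fun p _ => hasFiniteSupport_coeff_mul_coeff (coeff p.1 F) (coeff p.2 G) n).symm

theorem paramCoeff_rename (e : σ → ρ) [Filter.TendstoCofinite e] (n : ℤ) (F : LocalSeries σ) :
    paramCoeff n (rename e F) = rename e (paramCoeff n F) := by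
  ext d
  rw [coeff_paramCoeff, coeff_rename, coeff_rename, HahnSeries.coeff_sum]
  rfl

theorem rename_smul_localSeries (e : σ → ρ) [Filter.TendstoCofinite e] (a : MvPowerSeries σ ℂ)
    (F : LocalSeries σ) : rename e (a • F) = rename e a • rename e F :=
  ext_paramCoeff fun n => by
    rw [paramCoeff_rename, map_smul (paramCoeff n) a F, map_smul (paramCoeff n) (rename e a),
      paramCoeff_rename, smul_eq_mul, smul_eq_mul, map_mul]

/-- A Laurent series in `w` with coefficients in `ℂ⟦σ⟧`, read as a power series in the variables
`σ`. The image consists of the series whose powers of `w` are bounded below uniformly in the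
monomials. -/
def ofLaurent : LaurentSeries (MvPowerSeries σ ℂ) →+* LocalSeries σ where
  toFun u := fun d => u.map (coeff d)
  map_zero' := by
    ext d n
    change coeff d ((0 : LaurentSeries (MvPowerSeries σ ℂ)).coeff n) = 0
    simp
  map_add' u v := by
    ext d n
    exact map_add (coeff d) (u.coeff n) (v.coeff n)
  map_one' := by
    classical
    refine ext_paramCoeff fun n => ?_
    ext d
    change coeff d ((1 : LaurentSeries (MvPowerSeries σ ℂ)).coeff n) =
      (coeff d (1 : LocalSeries σ)).coeff n
    rw [coeff_one, HahnSeries.coeff_one]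
    split_ifs <;> simp_all [coeff_one, HahnSeries.coeff_one]
  map_mul' u v := ext_paramCoeff fun n =>
    (coeff_mul_eq_finsum u v n).trans <|
      (locSum_eq_finsum (hasFiniteSupport_coeff_mul_coeff u v n)).symm.trans
        (paramCoeff_mul (fun d => u.map (coeff d)) (fun d => v.map (coeff d)) n).symm

theorem paramCoeff_ofLaurent (n : ℤ) (u : LaurentSeries (MvPowerSeries σ ℂ)) :
    paramCoeff n (ofLaurent u) = u.coeff n := rfl

theorem ofLaurent_smul (a : MvPowerSeries σ ℂ) (u : LaurentSeries (MvPowerSeries σ ℂ)) :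
    ofLaurent (a • u) = a • ofLaurent u :=
  ext_paramCoeff fun n => by
    rw [map_smul (paramCoeff n), paramCoeff_ofLaurent, paramCoeff_ofLaurent, HahnSeries.coeff_smul]

theorem paramCoeff_ofLaurent_single_mul (n q : ℤ) (r : MvPowerSeries σ ℂ) (F : LocalSeries σ) :
    paramCoeff n (ofLaurent (HahnSeries.single q r) * F) = r * paramCoeff (n - q) F := by
  ext d
  rw [paramCoeff_mul, zProd, coeff_locSum, finsum_eq_single _ q, paramCoeff_ofLaurent,
    HahnSeries.coeff_single_same]
  intro k hk
  rw [paramCoeff_ofLaurent, HahnSeries.coeff_single_of_ne hk, zero_mul, map_zero]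

theorem inZ_eq_paramCoeff (p : PowerSeries (MvPowerSeries σ ℂ)) (n : ℤ) :
    inZ p n = paramCoeff n (ofLaurent (HahnSeries.ofPowerSeries ℤ _ p)) := by
  rw [paramCoeff_ofLaurent, PowerSeries.coeff_coe, inZ]
  by_cases h : 0 ≤ n
  · rw [if_pos h, if_neg h.not_gt, show n.natAbs = n.toNat by omega]
  · rw [if_neg h, if_pos (not_le.1 h)]

theorem zProd_inZ_inZ (p q : PowerSeries (MvPowerSeries σ ℂ)) :
    zProd (inZ p) (inZ q) = inZ (p * q) := by
  funext n
  simp only [funext (inZ_eq_paramCoeff _), ← paramCoeff_mul, map_mul]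

theorem zProd_comp_neg (f g : ZSeries σ) (n : ℤ) :
    zProd (fun k => f (-k)) (fun k => g (-k)) n = zProd f g (-n) := by
  unfold zProd
  rw [← locSum_comp_equiv (Equiv.neg ℤ) fun k => f k * g (-n - k)]
  simp only [Equiv.neg_apply, neg_sub, sub_neg_eq_add, neg_add_eq_sub]

theorem zProd_inZ_inZInv (p q : PowerSeries (MvPowerSeries σ ℂ)) (n : ℤ) :
    zProd (inZ p) (inZInv q) n = zProd (inZInv p) (inZ q) (-n) := by
  rw [← zProd_comp_neg]
  simp only [inZInv, neg_neg]
  rfl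

end LocalSeries

section Exponentials

/-- Power series in `w` over `ℂ⟦t⟧` whose coefficient of `wᵏ` has weight at least `k`, where
`t^{(i)}_k` has weight `k`. This bound is what makes `e^{ξ(t,w⁻¹)}` a `LocalSeries`. -/
def weightSubring : Subring (PowerSeries TimeSeries) where
  carrier := {p | ∀ (k : ℕ) (d : Times →₀ ℕ), Finsupp.weight (fun s : Times => (s.2 : ℕ)) d < k →
    coeff d (PowerSeries.coeff k p) = 0}
  zero_mem' k d _ := by rw [map_zero, map_zero]
  one_mem' k d h := by rw [PowerSeries.coeff_one, if_neg (by omega), map_zero]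
  add_mem' hp hq k d h := by rw [map_add, map_add, hp k d h, hq k d h, add_zero]
  neg_mem' hp k d h := by rw [map_neg, map_neg, hp k d h, neg_zero]
  mul_mem' {p q} hp hq k d h := by
    classical
    rw [PowerSeries.coeff_mul, map_sum]
    refine Finset.sum_eq_zero fun x hx => ?_
    rw [coeff_mul]
    refine Finset.sum_eq_zero fun y hy => ?_
    rw [Finset.HasAntidiagonal.mem_antidiagonal] at hx hy
    rw [← hy, map_add] at h
    rcases lt_or_ge (Finsupp.weight (fun s : Times => (s.2 : ℕ)) y.1) x.1 with h₁ | h₁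
    · rw [hp _ _ h₁, zero_mul]
    · rw [hq x.2 y.2 (by omega), mul_zero]

theorem smul_xi_mem_weightSubring (i : Fin 3) (c : ℂ) : c • xi i ∈ weightSubring := by
  classical
  intro k d h
  rw [PowerSeries.coeff_smul, coeff_smul, xi, PowerSeries.coeff_mk]
  split_ifs with hk
  · rw [coeff_X, if_neg, mul_zero]
    rintro rfl
    simp [Finsupp.weight_single] at h
  · rw [map_zero, mul_zero]

theorem expXi_mem_weightSubring (i : Fin 3) (c : ℂ) : expXi i c ∈ weightSubring := by
  intro k d h
  have hfin := PowerSeries.coeff_subst_finite' (hasSubst_smul_xi i c) (PowerSeries.exp ℂ) k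
  rw [expXi, PowerSeries.coeff_subst' (hasSubst_smul_xi i c),
    finsum_eq_sum_of_support_subset (s := hfin.toFinset) _ (by simp), map_sum]
  refine Finset.sum_eq_zero fun j _ => ?_
  rw [coeff_smul, pow_mem (smul_xi_mem_weightSubring i c) j k d h, mul_zero]

theorem expXi_mul_expXi_neg (i : Fin 3) : expXi i 1 * expXi i (-1) = 1 := by
  have hx := hasSubst_smul_xi i 1
  have hneg : expXi i (-1) =
      (PowerSeries.evalNegHom (PowerSeries.exp ℂ)).subst ((1 : ℂ) • xi i) := by
    rw [PowerSeries.evalNegHom, PowerSeries.rescale_eq_subst,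
      PowerSeries.subst_comp_subst_apply (PowerSeries.HasSubst.smul_X' _) hx,
      PowerSeries.subst_smul hx, PowerSeries.subst_X hx, smul_smul, mul_one]
    rfl
  rw [hneg, expXi, ← PowerSeries.subst_mul hx, PowerSeries.exp_mul_exp_neg_eq_one,
    ← PowerSeries.coe_substAlgHom hx, map_one]

theorem bddBelow_support_coeff_expXi (i : Fin 3) (c : ℂ) (d : Times →₀ ℕ) :
    BddBelow (Function.support fun n => coeff d (inZInv (expXi i c) n)) := by
  refine ⟨-(Finsupp.weight (fun s : Times => (s.2 : ℕ)) d : ℤ), fun n hn => ?_⟩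
  by_contra! h
  refine hn ?_
  simp only [inZInv, inZ]
  rw [if_pos (by omega)]
  exact expXi_mem_weightSubring i c _ d (by omega)

/-- `exp(c ξ(t^{(i)}, w⁻¹))`. -/
def expLocal (i : Fin 3) (c : ℂ) : LocalSeries Times :=
  fun d => HahnSeries.ofSuppBddBelow _ (bddBelow_support_coeff_expXi i c d)

theorem paramCoeff_expLocal (i : Fin 3) (c : ℂ) (n : ℤ) :
    paramCoeff n (expLocal i c) = inZInv (expXi i c) n := rfl

theorem expLocal_mul_expLocal_neg (i : Fin 3) : expLocal i 1 * expLocal i (-1) = 1 := by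
  refine ext_paramCoeff fun n => ?_
  simp only [paramCoeff_mul, paramCoeff_expLocal, inZInv]
  rw [zProd_comp_neg, zProd_inZ_inZ, expXi_mul_expXi_neg, inZ_eq_paramCoeff, map_one, map_one,
    ← map_one ofLaurent, paramCoeff_ofLaurent, paramCoeff_ofLaurent]
  by_cases hn : n = 0 <;> simp [HahnSeries.coeff_one, hn]

end Exponentials

section Shift

theorem wCoeff_zero_eq_killCompl (f : MvPowerSeries (Times ⊕ Unit) ℂ) :
    wCoeff 0 f = killCompl (Function.Embedding.inl : Times ↪ Times ⊕ Unit) f := by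
  ext d
  have hd : Finsupp.sumElim d (Finsupp.single () 0) =
      Finsupp.embDomain (Function.Embedding.inl : Times ↪ Times ⊕ Unit) d := by
    ext (s | s)
    · exact (Finsupp.embDomain_apply_self (Function.Embedding.inl : Times ↪ Times ⊕ Unit) d s).symm
    · rw [Finsupp.embDomain_of_notMem_range _ _ _ (by simp), Finsupp.sumElim_apply]
      simp
  rw [coeff_wCoeff, coeff_killCompl, hd]

theorem killCompl_shiftedTimes (i : Fin 3) (c : ℂ) (s : Times) :
    killCompl (Function.Embedding.inl : Times ↪ Times ⊕ Unit) (shiftedTimes i c s) = X s := by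
  have hl : killCompl (R := ℂ) (Function.Embedding.inl : Times ↪ Times ⊕ Unit)
      (X (Sum.inl s)) = X s := killCompl_X s
  have hr : killCompl (R := ℂ) (Function.Embedding.inl : Times ↪ Times ⊕ Unit)
      (X (Sum.inr ())) = 0 := killCompl_X_eq_zero (by simp)
  unfold shiftedTimes
  split_ifs <;> simp [hl, hr]

theorem coeff_zero_shiftSeries (i : Fin 3) (c : ℂ) (f : TimeSeries) :
    PowerSeries.coeff 0 (shiftSeries i c f) = f := by
  classical
  have hmonomial (x d : Times →₀ ℕ) : coeff (Finsupp.embDomain Function.Embedding.inl d)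
      (x.prod fun s n => shiftedTimes i c s ^ n) = coeff d (monomial x (1 : ℂ)) := by
    rw [← coeff_killCompl, map_finsuppProd, monomial_one_eq]
    simp only [map_pow, killCompl_shiftedTimes]
  rw [shiftSeries, PowerSeries.coeff_mk, wCoeff_zero_eq_killCompl]
  ext d
  rw [coeff_killCompl, coeff_subst (hasSubst_shiftedTimes i c), finsum_eq_single _ d]
  · rw [hmonomial, coeff_monomial_same, smul_eq_mul, mul_one]
  · intro x hx
    rw [hmonomial, coeff_monomial_ne hx.symm, smul_zero]

end Shift

section Waves

variable (τ : Lattice → TimeSeries)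

/-- The three wave functions as one family. -/
def psi (i : Fin 3) (m : Lattice) : Wave := ![Psi1 τ m, Psi2 τ m, Psi3 τ m] i

/-- The three adjoint wave functions as one family. -/
def adjPsi (i : Fin 3) (m : Lattice) : Wave := ![adjPsi1 τ m, adjPsi2 τ m, adjPsi3 τ m] i

/-- The sign `ε i` with `z = w ^ ε i`, where `w` is the local parameter at the point around which
the `i`-th wave function is expanded (`z = ∞` for `i = 0` and `z = 0` for `i = 1, 2`). It is also
the sign of `dz / z` against `dw / w`. -/
def paramSign : Fin 3 → ℤˣ := ![-1, 1, 1]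

/-- The order in `w` of the `i`-th wave function, once its exponential factor is removed. -/
def waveOrder (i : Fin 3) (m : Lattice) : ℤ := ![-m.1, m.2, m.1 - m.2] i

/-- The sign in front of the `i`-th wave function. -/
def waveSign (i : Fin 3) (m : Lattice) : ℂ := ![1, 1, (-1) ^ m.2] i

/-- The shift of `m` in the numerator of the `i`-th wave function. -/
def tauShift : Fin 3 → Lattice := ![0, (1, 1), (1, 0)]

/-- The numerator of the `i`-th wave function without its exponential factor. -/
def waveAmplitude (m : Lattice) (i : Fin 3) : LaurentSeries TimeSeries :=
  HahnSeries.single (waveOrder i m) (C (waveSign i m)) *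
    HahnSeries.ofPowerSeries ℤ _ (shiftSeries i (-1) (τ (m + tauShift i)))

/-- The numerator of the `i`-th adjoint wave function without its exponential factor. -/
def adjWaveAmplitude (m : Lattice) (i : Fin 3) : LaurentSeries TimeSeries :=
  HahnSeries.single (paramSign i - waveOrder i m) (C (waveSign i m)) *
    HahnSeries.ofPowerSeries ℤ _ (shiftSeries i 1 (τ (m - tauShift i)))

/-- Multiplication of a triple of amplitudes by the exponentials `exp(c ξ(t^{(i)}, w⁻¹))`. -/
def dress (c : ℂ) :
    (Fin 3 → LaurentSeries TimeSeries) →ₗ[TimeSeries] (Fin 3 → LocalSeries Times) where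
  toFun u i := expLocal i c * ofLaurent (u i)
  map_add' u v := funext fun i => by
    rw [Pi.add_apply, map_add, mul_add]
    rfl
  map_smul' a u := funext fun i => by
    rw [Pi.smul_apply, ofLaurent_smul, mul_smul_comm]
    rfl

/-- The numerators of the three wave functions, as series in the local parameter. -/
def localWave (m : Lattice) : Fin 3 → LocalSeries Times :=
  dress 1 (waveAmplitude τ m)

/-- The numerators of the three adjoint wave functions, as series in the local parameter. -/
def adjLocalWave (m : Lattice) : Fin 3 → LocalSeries Times :=
  dress (-1) (adjWaveAmplitude τ m)

theorem dress_apply (c : ℂ) (u : Fin 3 → LaurentSeries TimeSeries) (i : Fin 3) :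
    dress c u i = expLocal i c * ofLaurent (u i) := rfl

theorem paramCoeff_expLocal_mul_ofLaurent (i : Fin 3) (c x : ℂ) (p n : ℤ)
    (q : PowerSeries TimeSeries) :
    paramCoeff n (expLocal i c * ofLaurent (HahnSeries.single p (C x) *
      HahnSeries.ofPowerSeries ℤ _ q)) =
      x • zProd (inZInv (expXi i c)) (inZ q) (n - p) := by
  rw [map_mul ofLaurent, mul_left_comm, paramCoeff_ofLaurent_single_mul, paramCoeff_mul,
    ← smul_eq_C_mul]
  simp only [paramCoeff_expLocal, ← inZ_eq_paramCoeff]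

theorem psi_num (i : Fin 3) (m : Lattice) (n : ℤ) :
    (psi τ i m).num n = paramCoeff (paramSign i * n) (localWave τ m i) := by
  rw [localWave, dress_apply, waveAmplitude, paramCoeff_expLocal_mul_ofLaurent]
  fin_cases i
  · simp [psi, Psi1, zShift, paramSign, waveOrder, waveSign, tauShift, zProd_inZ_inZInv,
      neg_add_eq_sub]
  · simp [psi, Psi2, zShift, paramSign, waveOrder, waveSign, tauShift]
  · simp [psi, Psi3, zShift, paramSign, waveOrder, waveSign, tauShift]

theorem adjPsi_num (i : Fin 3) (m : Lattice) (n : ℤ) :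
    (adjPsi τ i m).num n = paramCoeff (paramSign i * n) (adjLocalWave τ m i) := by
  rw [adjLocalWave, dress_apply, adjWaveAmplitude, paramCoeff_expLocal_mul_ofLaurent]
  fin_cases i
  · have hexp : -m.1 + 1 - n = -n - (-1 + m.1) := by ring
    simp [adjPsi, adjPsi1, zShift, paramSign, waveOrder, waveSign, tauShift, zProd_inZ_inZInv, hexp]
  · have hexp : -m.2 + 1 = 1 - m.2 := by ring
    simp [adjPsi, adjPsi2, zShift, paramSign, waveOrder, waveSign, tauShift, hexp]
  · have hexp : -m.1 + m.2 + 1 = 1 - (m.1 - m.2) := by ring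
    simp [adjPsi, adjPsi3, zShift, paramSign, waveOrder, waveSign, tauShift, hexp]

theorem psi_den (i : Fin 3) (m : Lattice) : (psi τ i m).den = τ m := by
  fin_cases i <;> rfl

theorem adjPsi_den (i : Fin 3) (m : Lattice) : (adjPsi τ i m).den = τ m := by
  fin_cases i <;> rfl

end Waves

section Pairing

/-- The difference of the two sides of the bilinear equation for `t` and `t'`, with all the
residues taken in the local parameter and the denominators cleared. -/
def pairing (F G : Fin 3 → LocalSeries Times) : TimeSeries₂ :=
  ∑ i, (paramSign i : ℤ) • paramCoeff 0
    (rename (Function.Embedding.inl : Times ↪ Times ⊕ Times) (F i) *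
      rename (Function.Embedding.inr : Times ↪ Times ⊕ Times) (G i))

theorem pairing_zero_left (G : Fin 3 → LocalSeries Times) : pairing 0 G = 0 := by
  simp only [pairing, Pi.zero_apply, map_zero, zero_mul, smul_zero, Finset.sum_const_zero]

theorem pairing_add_left (F F' G : Fin 3 → LocalSeries Times) :
    pairing (F + F') G = pairing F G + pairing F' G := by
  simp only [pairing, Pi.add_apply, map_add, add_mul, smul_add, Finset.sum_add_distrib]

theorem pairing_smul_left (a : TimeSeries) (F G : Fin 3 → LocalSeries Times) :
    pairing (a • F) G = atT a * pairing F G := by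
  rw [pairing, pairing, Finset.mul_sum]
  refine Finset.sum_congr rfl fun i _ => ?_
  rw [Pi.smul_apply, rename_smul_localSeries, smul_mul_assoc, map_smul (paramCoeff 0), smul_eq_mul,
    mul_smul_comm]
  rfl

instance : Filter.TendstoCofinite (Sum.elim id id : Times ⊕ Times → Times) := by
  refine (Filter.tendstoCofinite_iff_finite_preimage_singleton _).2 fun t => ?_
  refine (Set.toFinite {Sum.inl t, Sum.inr t}).subset ?_
  rintro (x | x) hx <;> simp_all

/-- The restriction of a function of `(t, t')` to the diagonal `t' = t`. -/
def diag : TimeSeries₂ →ₐ[ℂ] TimeSeries := rename (Sum.elim id id)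

theorem diag_paramCoeff_mul (n : ℤ) (F G : LocalSeries Times) :
    diag (paramCoeff n (rename (Function.Embedding.inl : Times ↪ Times ⊕ Times) F *
      rename (Function.Embedding.inr : Times ↪ Times ⊕ Times) G)) = paramCoeff n (F * G) := by
  rw [diag, ← paramCoeff_rename, map_mul, rename_rename, rename_rename]
  exact congrArg (paramCoeff n) (congrArg₂ (· * ·) (rename_id_apply F) (rename_id_apply G))

theorem diag_pairing (F G : Fin 3 → LocalSeries Times) :
    diag (pairing F G) = ∑ i, (paramSign i : ℤ) • paramCoeff 0 (F i * G i) := by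
  simp only [pairing, map_sum, map_zsmul, diag_paramCoeff_mul]

theorem diag_pairing_dress (u v : Fin 3 → LaurentSeries TimeSeries) :
    diag (pairing (dress 1 u) (dress (-1) v)) = ∑ i, (paramSign i : ℤ) • (u i * v i).coeff 0 := by
  rw [diag_pairing]
  refine Finset.sum_congr rfl fun i _ => ?_
  rw [dress_apply, dress_apply, mul_mul_mul_comm, expLocal_mul_expLocal_neg, one_mul, ← map_mul,
    paramCoeff_ofLaurent]

theorem zProd_atT_atT' (s : ℤˣ) (F G : LocalSeries Times) :
    zProd (fun n => atT (paramCoeff (s * n) F)) (fun n => atT' (paramCoeff (s * n) G)) 0 =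
      paramCoeff 0 (rename (Function.Embedding.inl : Times ↪ Times ⊕ Times) F *
        rename (Function.Embedding.inr : Times ↪ Times ⊕ Times) G) := by
  rw [paramCoeff_mul]
  unfold zProd
  rw [← locSum_comp_equiv s.mulLeft fun k => paramCoeff k (rename _ F) *
    paramCoeff (0 - k) (rename _ G)]
  simp only [paramCoeff_rename, Units.mulLeft_apply, zero_sub, mul_neg]
  rfl

theorem contour_eq_div {f g : Wave} {F G : LocalSeries Times} (s : ℤˣ)
    (hf : ∀ n, f.num n = paramCoeff (s * n) F) (hg : ∀ n, g.num n = paramCoeff (s * n) G) :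
    contour f g =
      algebraMap TimeSeries₂ TimeField₂
        (paramCoeff 0 (rename (Function.Embedding.inl : Times ↪ Times ⊕ Times) F *
          rename (Function.Embedding.inr : Times ↪ Times ⊕ Times) G)) /
      (algebraMap TimeSeries₂ TimeField₂ (atT f.den) *
        algebraMap TimeSeries₂ TimeField₂ (atT' g.den)) := by
  simp only [contour, hf, hg, zProd_atT_atT']

theorem atT_injective : Function.Injective atT := rename_injective _

theorem atT'_injective : Function.Injective atT' := rename_injective _

variable (τ : Lattice → TimeSeries)

theorem psi_zMul_num (i : Fin 3) (m : Lattice) (k n : ℤ) :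
    ((psi τ i m).zMul (-(paramSign i * k))).num n =
      paramCoeff (paramSign i * n) (ofLaurent (HahnSeries.single (-k) 1) * localWave τ m i) := by
  have hexp : (paramSign i : ℤ) * (n - -(paramSign i * k)) = paramSign i * n - -k := by
    linear_combination k * Int.units_coe_mul_self (paramSign i)
  rw [paramCoeff_ofLaurent_single_mul, one_mul, ← hexp]
  exact psi_num τ i m _

theorem sum_contour_eq_div (k : Fin 3 → ℤ) (m m' : Lattice) :
    ∑ i, (paramSign i : ℤ) • contour ((psi τ i m).zMul (-(paramSign i * k i))) (adjPsi τ i m') =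
      algebraMap TimeSeries₂ TimeField₂
        (pairing (fun i => ofLaurent (HahnSeries.single (-k i) 1) * localWave τ m i)
          (adjLocalWave τ m')) /
      (algebraMap TimeSeries₂ TimeField₂ (atT (τ m)) *
        algebraMap TimeSeries₂ TimeField₂ (atT' (τ m'))) := by
  rw [pairing, map_sum, Finset.sum_div]
  refine Finset.sum_congr rfl fun i _ => ?_
  rw [contour_eq_div (paramSign i) (psi_zMul_num τ i m (k i)) (adjPsi_num τ i m'), Wave.zMul,
    psi_den, adjPsi_den, map_zsmul, smul_div_assoc]

variable {τ} in
theorem contour_eq_add_iff_pairing_eq_zero (hτ : ∀ m, τ m ≠ 0) (k : Fin 3 → ℤ) (m m' : Lattice) :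
    contour ((Psi1 τ m).zMul (k 0)) (adjPsi1 τ m') =
        contour ((Psi2 τ m).zMul (-k 1)) (adjPsi2 τ m') +
          contour ((Psi3 τ m).zMul (-k 2)) (adjPsi3 τ m') ↔
      pairing (fun i => ofLaurent (HahnSeries.single (-k i) 1) * localWave τ m i)
        (adjLocalWave τ m') = 0 := by
  have hi := IsFractionRing.injective TimeSeries₂ TimeField₂
  have hden : algebraMap TimeSeries₂ TimeField₂ (atT (τ m)) *
      algebraMap TimeSeries₂ TimeField₂ (atT' (τ m')) ≠ 0 :=
    mul_ne_zero ((map_ne_zero_iff _ hi).2 ((map_ne_zero_iff _ atT_injective).2 (hτ m)))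
      ((map_ne_zero_iff _ hi).2 ((map_ne_zero_iff _ atT'_injective).2 (hτ m')))
  have hsum := sum_contour_eq_div τ k m m'
  rw [Fin.sum_univ_three] at hsum
  simp only [psi, adjPsi, paramSign, Matrix.cons_val_zero, Matrix.cons_val_one, Matrix.cons_val,
    Units.val_neg, Units.val_one, neg_mul, one_mul, neg_neg, neg_smul, one_smul] at hsum
  rw [← map_eq_zero_iff _ hi, ← div_eq_zero_iff.trans (or_iff_left hden), ← hsum]
  constructor <;> intro h <;> linear_combination -h

end Pairing

section Annihilator

variable (τ : Lattice → TimeSeries)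

/-- The triples of series that satisfy the bilinear relation with all adjoint wave functions. -/
def adjWaveAnnihilator : Submodule TimeSeries (Fin 3 → LocalSeries Times) where
  carrier := {F | ∀ m', pairing F (adjLocalWave τ m') = 0}
  zero_mem' _ := pairing_zero_left _
  add_mem' hF hF' m' := by rw [pairing_add_left, hF, hF', add_zero]
  smul_mem' a F hF m' := by rw [pairing_smul_left, hF, mul_zero]

theorem smul_mem_adjWaveAnnihilator_iff {a : TimeSeries} (ha : a ≠ 0)
    {F : Fin 3 → LocalSeries Times} :
    a • F ∈ adjWaveAnnihilator τ ↔ F ∈ adjWaveAnnihilator τ := by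
  refine ⟨fun h m' => ?_, (adjWaveAnnihilator τ).smul_mem a⟩
  have := h m'
  rw [pairing_smul_left] at this
  exact (mul_eq_zero.1 this).resolve_left ((map_ne_zero_iff _ atT_injective).2 ha)

/-- The eigenvalues `(z^{n₁}, z^{-n₂}, z^{-n₃})`; in the local parameters all of them are negative
powers. -/
def localEigenvalue (n : Fin 3 → ℕ) : Fin 3 → LocalSeries Times :=
  fun i => ofLaurent (HahnSeries.single (-(n i : ℤ)) 1)

theorem localEigenvalue_pow_mul (n : Fin 3 → ℕ) (l : ℕ) (F : Fin 3 → LocalSeries Times) :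
    localEigenvalue n ^ l * F =
      fun i => ofLaurent (HahnSeries.single (-(n i * l : ℤ)) 1) * F i := by
  funext i
  rw [Pi.mul_apply, Pi.pow_apply, localEigenvalue, ← map_pow, HahnSeries.single_pow, one_pow,
    nsmul_eq_mul, mul_neg, mul_comm (l : ℤ)]

variable {τ}

theorem kdvBilinear_iff (hτ : ∀ m, τ m ≠ 0) (n : Fin 3 → ℕ) :
    KdVBilinear (n 0) (n 1) (n 2) τ ↔
      ∀ l m, localEigenvalue n ^ l * localWave τ m ∈ adjWaveAnnihilator τ := by
  simp only [localEigenvalue_pow_mul]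
  exact forall₃_congr fun l m m' =>
    contour_eq_add_iff_pairing_eq_zero hτ (fun i => (n i * l : ℤ)) m m'

theorem Wave.zMul_zero (f : Wave) : f.zMul 0 = f :=
  congrArg (Wave.mk · f.den) (funext fun n => congrArg f.num (sub_zero n))

theorem kpBilinear_iff (hτ : ∀ m, τ m ≠ 0) :
    KPBilinear τ ↔ ∀ m, localWave τ m ∈ adjWaveAnnihilator τ := by
  have hkp : KPBilinear τ ↔ KdVBilinear 0 0 0 τ := by
    simp only [KPBilinear, KdVBilinear, Nat.cast_zero, zero_mul, neg_zero, Wave.zMul_zero,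
      forall_const]
  have hone : localEigenvalue 0 = 1 := funext fun _ => map_one ofLaurent
  rw [hkp, show KdVBilinear 0 0 0 τ ↔ _ from kdvBilinear_iff hτ 0, hone]
  simp only [one_pow, one_mul, forall_const]

end Annihilator

section Vanishing

theorem orderTop_single_mul_ofPowerSeries {R : Type*} [Semiring R] [NoZeroDivisors R] {x : R}
    (hx : x ≠ 0) (p : ℤ) {q : PowerSeries R} (hq : PowerSeries.coeff 0 q ≠ 0) :
    (HahnSeries.single p x * HahnSeries.ofPowerSeries ℤ R q).orderTop = p := by
  have hq_order : (HahnSeries.ofPowerSeries ℤ R q).orderTop = (0 : ℤ) := by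
    refine HahnSeries.orderTop_eq_of_le ?_ fun n hn => ?_
    · rwa [HahnSeries.mem_support, PowerSeries.coeff_coe, if_neg (lt_irrefl 0)]
    · by_contra! hneg
      rw [HahnSeries.mem_support, PowerSeries.coeff_coe, if_pos hneg] at hn
      exact hn rfl
  rw [HahnSeries.orderTop_mul, HahnSeries.orderTop_single hx, hq_order, ← WithTop.coe_add, add_zero]

theorem exists_waveOrder {a : Fin 3 → ℤ} (ha : 0 < a 0 + a 1 + a 2) (i : Fin 3) {b : ℤ}
    (hb : a i ≤ b) :
    ∃ m, waveOrder i m = b + paramSign i ∧ ∀ j ≠ i, waveOrder j m < a j + paramSign j := by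
  have horder (m : Lattice) :
      waveOrder 0 m = -m.1 ∧ waveOrder 1 m = m.2 ∧ waveOrder 2 m = m.1 - m.2 := ⟨rfl, rfl, rfl⟩
  have hsign : (paramSign 0 : ℤ) = -1 ∧ (paramSign 1 : ℤ) = 1 ∧ (paramSign 2 : ℤ) = 1 :=
    ⟨rfl, rfl, rfl⟩
  match i with
  | 0 => exact ⟨(1 - b, a 1), by grind⟩
  | 1 => exact ⟨(2 - a 0, b + 1), by grind⟩
  | 2 => exact ⟨(2 - a 0, 1 - a 0 - b), by grind⟩

variable {τ : Lattice → TimeSeries}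

theorem waveSign_ne_zero (i : Fin 3) (m : Lattice) : waveSign i m ≠ 0 := by
  fin_cases i <;> simp [waveSign, zpow_ne_zero]

theorem orderTop_waveAmplitude (hτ : ∀ m, τ m ≠ 0) (i : Fin 3) (m : Lattice) :
    (waveAmplitude τ m i).orderTop = waveOrder i m :=
  orderTop_single_mul_ofPowerSeries ((map_ne_zero_iff _ C_injective).2 (waveSign_ne_zero i m))
    _ (by rw [coeff_zero_shiftSeries]; exact hτ _)

theorem orderTop_adjWaveAmplitude (hτ : ∀ m, τ m ≠ 0) (i : Fin 3) (m : Lattice) :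
    (adjWaveAmplitude τ m i).orderTop = ((paramSign i - waveOrder i m : ℤ) : WithTop ℤ) :=
  orderTop_single_mul_ofPowerSeries ((map_ne_zero_iff _ C_injective).2 (waveSign_ne_zero i m))
    _ (by rw [coeff_zero_shiftSeries]; exact hτ _)

theorem coeff_zero_mul_adjWaveAmplitude_eq_zero (hτ : ∀ m, τ m ≠ 0)
    {u : LaurentSeries TimeSeries} {a : ℤ} (hu : (a : WithTop ℤ) ≤ u.orderTop) {i : Fin 3}
    {m : Lattice} (h : waveOrder i m < a + paramSign i) :
    (u * adjWaveAmplitude τ m i).coeff 0 = 0 := by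
  refine HahnSeries.coeff_eq_zero_of_lt_orderTop (lt_of_lt_of_le ?_ HahnSeries.orderTop_add_le_mul)
  rw [orderTop_adjWaveAmplitude hτ]
  refine lt_of_lt_of_le ?_ (add_le_add_left hu _)
  exact_mod_cast (by omega : 0 < a + (paramSign i - waveOrder i m))

theorem coeff_zero_mul_adjWaveAmplitude_ne_zero (hτ : ∀ m, τ m ≠ 0)
    {u : LaurentSeries TimeSeries} (hu : u ≠ 0) {i : Fin 3} {m : Lattice}
    (h : waveOrder i m = u.order + paramSign i) :
    (u * adjWaveAmplitude τ m i).coeff 0 ≠ 0 := by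
  refine HahnSeries.coeff_orderTop_ne ?_
  rw [HahnSeries.orderTop_mul, orderTop_adjWaveAmplitude hτ,
    ← HahnSeries.order_eq_orderTop_of_ne_zero hu, ← WithTop.coe_add, WithTop.coe_eq_coe, h]
  ring

/-- All residues but the `i`-th vanish for the `m` of `exists_waveOrder`, and the `i`-th one is a
product of leading coefficients. -/
theorem eq_zero_of_dress_mem_adjWaveAnnihilator (hτ : ∀ m, τ m ≠ 0)
    {u : Fin 3 → LaurentSeries TimeSeries} {a : Fin 3 → ℤ} (ha : 0 < a 0 + a 1 + a 2)
    (hu : ∀ i, (a i : WithTop ℤ) ≤ (u i).orderTop) (h : dress 1 u ∈ adjWaveAnnihilator τ) :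
    u = 0 := by
  funext i
  by_contra! hi
  have hai : a i ≤ (u i).order := by
    have := hu i
    rwa [← HahnSeries.order_eq_orderTop_of_ne_zero hi, WithTop.coe_le_coe] at this
  obtain ⟨m, hmi, hmj⟩ := exists_waveOrder ha i hai
  have hres : ∑ j, (paramSign j : ℤ) • (u j * adjWaveAmplitude τ m j).coeff 0 = 0 := by
    rw [← diag_pairing_dress, ← map_zero diag]
    exact congrArg diag (h m)
  rw [Finset.sum_eq_single i (fun j _ hj => by
    rw [coeff_zero_mul_adjWaveAmplitude_eq_zero hτ (hu j) (hmj j hj), smul_zero]) (by simp)] at hres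
  exact coeff_zero_mul_adjWaveAmplitude_ne_zero hτ hi hmi
    ((smul_eq_zero_iff_eq (paramSign i)).1 hres)

end Vanishing

section Elimination

theorem exists_elimination {R : Type*} [CommRing R] [IsDomain R] {u : LaurentSeries R}
    {w : ℕ → LaurentSeries R} {b : ℤ} (hu : (b : WithTop ℤ) ≤ u.orderTop)
    (hw : ∀ j : ℕ, (w j).orderTop = (b + j : ℤ)) (k : ℕ) :
    ∃ (A : R) (c : ℕ → R), A ≠ 0 ∧
      ((b + k : ℤ) : WithTop ℤ) ≤ (A • u - ∑ j ∈ Finset.range k, c j • w j).orderTop := by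
  induction k with
  | zero =>
    refine ⟨1, 0, one_ne_zero, ?_⟩
    rwa [Finset.range_zero, Finset.sum_empty, sub_zero, one_smul, Nat.cast_zero, add_zero]
  | succ k ih =>
    obtain ⟨A, c, hA, h⟩ := ih
    set r := A • u - ∑ j ∈ Finset.range k, c j • w j with hr
    let lead := (w k).coeff (b + k)
    refine ⟨lead * A, fun j => if j < k then lead * c j else r.coeff (b + k),
      mul_ne_zero (HahnSeries.coeff_orderTop_ne (hw k)) hA, ?_⟩
    have hstep : (lead * A) • u - ∑ j ∈ Finset.range (k + 1),
        (if j < k then lead * c j else r.coeff (b + k)) • w j =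
          lead • r - r.coeff (b + k) • w k := by
      rw [Finset.sum_range_succ, if_neg (lt_irrefl k), hr, smul_sub, Finset.smul_sum, smul_smul,
        sub_sub]
      congr 2
      refine Finset.sum_congr rfl fun j hj => ?_
      rw [if_pos (Finset.mem_range.1 hj), smul_smul]
    rw [hstep, HahnSeries.le_orderTop_iff_forall]
    intro n hn
    have hn : n < b + k + 1 := by
      rw [add_assoc]
      exact_mod_cast hn
    rw [HahnSeries.coeff_sub, HahnSeries.coeff_smul, HahnSeries.coeff_smul]
    rcases (Int.lt_add_one_iff.1 hn).lt_or_eq with hlt | rfl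
    · rw [HahnSeries.coeff_eq_zero_of_lt_orderTop ((WithTop.coe_lt_coe.2 hlt).trans_le h),
        HahnSeries.coeff_eq_zero_of_lt_orderTop ((WithTop.coe_lt_coe.2 hlt).trans_eq (hw k).symm),
        smul_zero, smul_zero, sub_zero]
    · exact sub_eq_zero.2 (mul_comm _ _)

end Elimination

section Relation

variable {τ : Lattice → TimeSeries}

/-- The exponents `(n₁ - j, -n₂)` of the shift operators in `𝔏`. -/
def opShift (n : Fin 3 → ℕ) (j : ℕ) : Lattice := (n 0 - j, -n 1)

theorem waveOrder_zero_add_opShift (n : Fin 3 → ℕ) (m : Lattice) (j : ℕ) :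
    waveOrder 0 (m + opShift n j) = waveOrder 0 m - n 0 + j := by
  change -(m.1 + (n 0 - j)) = -m.1 - n 0 + j
  ring

theorem waveOrder_one_add_opShift (n : Fin 3 → ℕ) (m : Lattice) (j : ℕ) :
    waveOrder 1 (m + opShift n j) = waveOrder 1 m - n 1 := rfl

theorem waveOrder_two_add_opShift (n : Fin 3 → ℕ) (m : Lattice) (j : ℕ) :
    waveOrder 2 (m + opShift n j) = waveOrder 2 m + n 0 + n 1 - j := by
  change m.1 + (n 0 - j) - (m.2 + -n 1) = m.1 - m.2 + n 0 + n 1 - j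
  ring

theorem sum_waveOrder (m : Lattice) :
    waveOrder 0 m + waveOrder 1 m + waveOrder 2 m = 0 := by
  change -m.1 + m.2 + (m.1 - m.2) = 0
  ring

/-- The amplitudes of the wave functions multiplied by the eigenvalues. -/
def eigenAmplitude (τ : Lattice → TimeSeries) (n : Fin 3 → ℕ) (m : Lattice) :
    Fin 3 → LaurentSeries TimeSeries :=
  fun i => HahnSeries.single (-(n i : ℤ)) 1 * waveAmplitude τ m i

theorem localEigenvalue_mul_localWave (n : Fin 3 → ℕ) (m : Lattice) :
    localEigenvalue n * localWave τ m = dress 1 (eigenAmplitude τ n m) := by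
  funext i
  rw [Pi.mul_apply, localEigenvalue, localWave, dress_apply, dress_apply, eigenAmplitude,
    map_mul ofLaurent, mul_left_comm]

theorem orderTop_eigenAmplitude (hτ : ∀ m, τ m ≠ 0) (n : Fin 3 → ℕ) (m : Lattice) (i : Fin 3) :
    (eigenAmplitude τ n m i).orderTop = (waveOrder i m - n i : ℤ) := by
  rw [eigenAmplitude, HahnSeries.orderTop_mul, HahnSeries.orderTop_single one_ne_zero,
    orderTop_waveAmplitude hτ, ← WithTop.coe_add, neg_add_eq_sub]

theorem le_orderTop_smul_sub_sum {R ι : Type*} [Ring R] {u : LaurentSeries R}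
    {w : ι → LaurentSeries R} {b : WithTop ℤ} (hu : b ≤ u.orderTop) (s : Finset ι)
    (hw : ∀ j ∈ s, b ≤ (w j).orderTop) (A : R) (c : ι → R) :
    b ≤ (A • u - ∑ j ∈ s, c j • w j).orderTop := by
  rw [HahnSeries.le_orderTop_iff_forall]
  intro n hn
  rw [HahnSeries.coeff_sub, HahnSeries.coeff_smul, HahnSeries.coeff_sum,
    HahnSeries.coeff_eq_zero_of_lt_orderTop (hn.trans_le hu), smul_zero, zero_sub, neg_eq_zero]
  refine Finset.sum_eq_zero fun j hj => ?_
  rw [HahnSeries.coeff_smul, HahnSeries.coeff_eq_zero_of_lt_orderTop (hn.trans_le (hw j hj)),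
    smul_zero]

/-- The coefficients are found by elimination in the first component; in the other two components
every term satisfies the bound. -/
theorem exists_le_orderTop_eigenAmplitude (hτ : ∀ m, τ m ≠ 0) (n : Fin 3 → ℕ) (m : Lattice) :
    ∃ (A : TimeSeries) (c : ℕ → TimeSeries), A ≠ 0 ∧ ∀ i,
      ((![waveOrder 0 m - n 0 + (n 0 + n 1 + n 2 + 1 : ℕ), waveOrder 1 m - n 1,
          waveOrder 2 m - n 2] i : ℤ) : WithTop ℤ) ≤
        ((A • eigenAmplitude τ n m - ∑ j ∈ Finset.range (n 0 + n 1 + n 2 + 1),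
          c j • waveAmplitude τ (m + opShift n j)) i).orderTop := by
  obtain ⟨A, c, hA, h0⟩ := exists_elimination (orderTop_eigenAmplitude hτ n m 0).ge
    (fun j => (orderTop_waveAmplitude hτ 0 _).trans
      (congrArg _ (waveOrder_zero_add_opShift n m j))) (n 0 + n 1 + n 2 + 1)
  refine ⟨A, c, hA, fun i => ?_⟩
  simp only [Pi.sub_apply, Pi.smul_apply, Finset.sum_apply]
  match i with
  | 0 => exact h0
  | 1 =>
    refine le_orderTop_smul_sub_sum (orderTop_eigenAmplitude hτ n m 1).ge _ (fun j _ => ?_) A c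
    rw [orderTop_waveAmplitude hτ, waveOrder_one_add_opShift]
  | 2 =>
    refine le_orderTop_smul_sub_sum (orderTop_eigenAmplitude hτ n m 2).ge _ (fun j hj => ?_) A c
    rw [orderTop_waveAmplitude hτ, waveOrder_two_add_opShift, WithTop.coe_le_coe]
    have := Finset.mem_range.1 hj
    omega

theorem exists_relation (hτ : ∀ m, τ m ≠ 0) (n : Fin 3 → ℕ)
    (hwave : ∀ m, localWave τ m ∈ adjWaveAnnihilator τ) (m : Lattice)
    (heigen : localEigenvalue n * localWave τ m ∈ adjWaveAnnihilator τ) :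
    ∃ (A : TimeSeries) (c : ℕ → TimeSeries), A ≠ 0 ∧
      A • (localEigenvalue n * localWave τ m) =
        ∑ j ∈ Finset.range (n 0 + n 1 + n 2 + 1), c j • localWave τ (m + opShift n j) := by
  obtain ⟨A, c, hA, horder⟩ := exists_le_orderTop_eigenAmplitude hτ n m
  refine ⟨A, c, hA, sub_eq_zero.1 ?_⟩
  have hdress : dress 1 (A • eigenAmplitude τ n m - ∑ j ∈ Finset.range (n 0 + n 1 + n 2 + 1),
      c j • waveAmplitude τ (m + opShift n j)) = A • (localEigenvalue n * localWave τ m) -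
        ∑ j ∈ Finset.range (n 0 + n 1 + n 2 + 1), c j • localWave τ (m + opShift n j) := by
    rw [localEigenvalue_mul_localWave]
    simp only [map_sub, map_smul, map_sum, localWave]
  have hpos : 0 < waveOrder 0 m - n 0 + (n 0 + n 1 + n 2 + 1 : ℕ) + (waveOrder 1 m - n 1) +
      (waveOrder 2 m - n 2) := by
    have := sum_waveOrder m
    omega
  rw [← hdress, eq_zero_of_dress_mem_adjWaveAnnihilator hτ hpos horder, map_zero]
  rw [hdress]
  exact sub_mem (Submodule.smul_mem _ _ heigen)
    (sum_mem fun j _ => Submodule.smul_mem _ _ (hwave _))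

end Relation

section Operators

variable {τ : Lattice → TimeSeries}

theorem algebraMap_timeField_ne_zero {a : TimeSeries} (ha : a ≠ 0) :
    algebraMap TimeSeries TimeField a ≠ 0 :=
  (map_ne_zero_iff _ (IsFractionRing.injective TimeSeries TimeField)).2 ha

theorem psi_coeff (i : Fin 3) (m : Lattice) (p : ℤ) :
    (psi τ i m).coeff p =
      algebraMap TimeSeries TimeField (paramCoeff (paramSign i * p) (localWave τ m i)) /
        algebraMap TimeSeries TimeField (τ m) := by
  rw [Wave.coeff, psi_num, psi_den]

theorem psi_zMul_coeff (n : Fin 3 → ℕ) (i : Fin 3) (m : Lattice) (p : ℤ) :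
    ((psi τ i m).zMul (-(paramSign i * n i))).coeff p =
      algebraMap TimeSeries TimeField
          (paramCoeff (paramSign i * p) ((localEigenvalue n * localWave τ m) i)) /
        algebraMap TimeSeries TimeField (τ m) := by
  rw [Wave.coeff, psi_zMul_num, Wave.zMul, psi_den]
  rfl

theorem sum_mul_psi_coeff_eq_iff (hτ : ∀ m, τ m ≠ 0) (n : Fin 3 → ℕ) (m : Lattice) {ι : Type*}
    {s : Finset ι} (e : ι → Lattice) {A : TimeSeries} (hA : A ≠ 0) {c : ι → TimeSeries}
    {a : ι → TimeField}
    (ha : ∀ j ∈ s, algebraMap TimeSeries TimeField (c j) = algebraMap TimeSeries TimeField A *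
      (a j * algebraMap TimeSeries TimeField (τ m) /
        algebraMap TimeSeries TimeField (τ (m + e j)))) :
    (∀ i p, ∑ j ∈ s, a j * (psi τ i (m + e j)).coeff p =
        ((psi τ i m).zMul (-(paramSign i * n i))).coeff p) ↔
      A • (localEigenvalue n * localWave τ m) = ∑ j ∈ s, c j • localWave τ (m + e j) := by
  have hcoeff (i : Fin 3) (p : ℤ) :
      ∑ j ∈ s, a j * (psi τ i (m + e j)).coeff p =
          ((psi τ i m).zMul (-(paramSign i * n i))).coeff p ↔
        paramCoeff (paramSign i * p) ((A • (localEigenvalue n * localWave τ m)) i) =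
          paramCoeff (paramSign i * p) ((∑ j ∈ s, c j • localWave τ (m + e j)) i) := by
    rw [psi_zMul_coeff, eq_div_iff (algebraMap_timeField_ne_zero (hτ m)),
      ← mul_right_inj' (algebraMap_timeField_ne_zero hA), Pi.smul_apply, Finset.sum_apply, map_sum,
      map_smul (paramCoeff _), smul_eq_mul,
      ← (IsFractionRing.injective TimeSeries TimeField).eq_iff, map_mul, map_sum, eq_comm,
      Finset.sum_mul, Finset.mul_sum]
    refine Eq.congr_right (Finset.sum_congr rfl fun j hj => ?_)
    rw [psi_coeff, Pi.smul_apply, map_smul (paramCoeff _), smul_eq_mul, map_mul, ha j hj]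
    ring
  simp only [hcoeff]
  rw [funext_iff]
  refine forall_congr' fun i => ⟨fun h => ext_paramCoeff fun p => ?_, fun h p => by rw [h]⟩
  have hp := h (paramSign i * p)
  rwa [← mul_assoc, Int.units_coe_mul_self, one_mul] at hp

variable (τ) in
/-- `L` multiplies the wave functions by `z^{n₁}`, `z^{-n₂}` and `z^{-n₃}`. -/
def IsEigenOperator (n : Fin 3 → ℕ) (L : DiffOp) : Prop :=
  ∀ i, (L.act fun m => (psi τ i m).coeff) = fun m => ((psi τ i m).zMul (-(paramSign i * n i))).coeff

theorem isEigenOperator_iff (n : Fin 3 → ℕ) (L : DiffOp) :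
    IsEigenOperator τ n L ↔
      (L.act fun m => (Psi1 τ m).coeff) = (fun m => ((Psi1 τ m).zMul (n 0)).coeff) ∧
        (L.act fun m => (Psi2 τ m).coeff) = (fun m => ((Psi2 τ m).zMul (-n 1)).coeff) ∧
          (L.act fun m => (Psi3 τ m).coeff) = fun m => ((Psi3 τ m).zMul (-n 2)).coeff := by
  simp [IsEigenOperator, Fin.forall_fin_succ, psi, paramSign]

theorem isEigenOperator_iff_forall (n : Fin 3 → ℕ) (L : DiffOp) :
    IsEigenOperator τ n L ↔ ∀ m i p, L.act (fun m => (psi τ i m).coeff) m p =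
      ((psi τ i m).zMul (-(paramSign i * n i))).coeff p := by
  simp only [IsEigenOperator, funext_iff]
  exact forall_comm

theorem act_sum_single {ι : Type*} (s : Finset ι) (e : ι → Lattice) (a : ι → CoeffRing)
    (f : Lattice → ℤ → TimeField) (m : Lattice) (p : ℤ) :
    DiffOp.act ⟨∑ j ∈ s, Finsupp.single (Multiplicative.ofAdd (e j)) (a j)⟩ f m p =
      ∑ j ∈ s, a j m * f (m + e j) p := by
  refine (Finsupp.sum_finsetSum_index (fun _ => zero_mul _)
    fun _ _ _ => add_mul _ _ _).symm.trans ?_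
  exact Finset.sum_congr rfl fun j _ => Finsupp.sum_single_index (zero_mul _)

theorem exists_isEigenOperator (hτ : ∀ m, τ m ≠ 0) (n : Fin 3 → ℕ)
    (hwave : ∀ m, localWave τ m ∈ adjWaveAnnihilator τ)
    (heigen : ∀ m, localEigenvalue n * localWave τ m ∈ adjWaveAnnihilator τ) :
    ∃ L, IsEigenOperator τ n L := by
  choose A c hA hrel using fun m => exists_relation hτ n hwave m (heigen m)
  let K := algebraMap TimeSeries TimeField
  let a : ℕ → CoeffRing := fun j m => K (c m j) * K (τ (m + opShift n j)) / (K (A m) * K (τ m))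
  refine ⟨⟨∑ j ∈ Finset.range (n 0 + n 1 + n 2 + 1),
    Finsupp.single (Multiplicative.ofAdd (opShift n j)) (a j)⟩,
    (isEigenOperator_iff_forall n _).2 fun m => ?_⟩
  simp only [act_sum_single]
  refine (sum_mul_psi_coeff_eq_iff hτ n m (opShift n) (hA m) fun j _ => ?_).2 (hrel m)
  have hA' := algebraMap_timeField_ne_zero (hA m)
  have hτm := algebraMap_timeField_ne_zero (hτ m)
  have hτj := algebraMap_timeField_ne_zero (hτ (m + opShift n j))
  simp only [a, K]
  field_simp

theorem IsEigenOperator.exists_relation (hτ : ∀ m, τ m ≠ 0) {n : Fin 3 → ℕ} {L : DiffOp}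
    (hL : IsEigenOperator τ n L) (m : Lattice) :
    ∃ (A : TimeSeries) (c : Multiplicative Lattice → TimeSeries), A ≠ 0 ∧
      A • (localEigenvalue n * localWave τ m) =
        ∑ j ∈ L.coeff.support, c j • localWave τ (m + j.toAdd) := by
  obtain ⟨A, hA⟩ := IsLocalization.exist_integer_multiples (nonZeroDivisors TimeSeries)
    L.coeff.support fun j => (L.coeff j m : TimeField) * algebraMap TimeSeries TimeField (τ m) /
      algebraMap TimeSeries TimeField (τ (m + j.toAdd))
  choose! c hc using hA
  have hA0 : (A : TimeSeries) ≠ 0 := nonZeroDivisors.coe_ne_zero A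
  refine ⟨A, c, hA0, (sum_mul_psi_coeff_eq_iff hτ n m _ hA0 fun j hj => ?_).1
    ((isEigenOperator_iff_forall n L).1 hL m)⟩
  exact (hc j hj).trans (Algebra.smul_def _ _)

theorem IsEigenOperator.localEigenvalue_pow_mul_mem (hτ : ∀ m, τ m ≠ 0) {n : Fin 3 → ℕ}
    {L : DiffOp} (hL : IsEigenOperator τ n L)
    (hwave : ∀ m, localWave τ m ∈ adjWaveAnnihilator τ) (l : ℕ) (m : Lattice) :
    localEigenvalue n ^ l * localWave τ m ∈ adjWaveAnnihilator τ := by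
  induction l generalizing m with
  | zero =>
    rw [pow_zero, one_mul]
    exact hwave m
  | succ l ih =>
    obtain ⟨A, c, hA, hrel⟩ := hL.exists_relation hτ m
    rw [← smul_mem_adjWaveAnnihilator_iff τ hA, pow_succ, mul_assoc, ← mul_smul_comm, hrel,
      Finset.mul_sum]
    refine sum_mem fun j _ => ?_
    rw [mul_smul_comm]
    exact Submodule.smul_mem _ _ (ih _)

end Operators

end KP3

end

theorem mainTheorem3 (n₁ n₂ n₃ : ℕ) (τ : KP3.Lattice → KP3.TimeSeries) (hτ : ∀ m, τ m ≠ 0) :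
    KP3.KdVBilinear n₁ n₂ n₃ τ ↔
      KP3.KPBilinear τ ∧
        ∃ L : KP3.DiffOp,
          (KP3.DiffOp.act L fun m => (KP3.Psi1 τ m).coeff) =
              (fun m => ((KP3.Psi1 τ m).zMul n₁).coeff) ∧
            (KP3.DiffOp.act L fun m => (KP3.Psi2 τ m).coeff) =
              (fun m => ((KP3.Psi2 τ m).zMul (-n₂)).coeff) ∧
            (KP3.DiffOp.act L fun m => (KP3.Psi3 τ m).coeff) =
              (fun m => ((KP3.Psi3 τ m).zMul (-n₃)).coeff) := by
  refine (KP3.kdvBilinear_iff hτ ![n₁, n₂, n₃]).trans ⟨fun h => ?_, fun ⟨hkp, L, hL⟩ => ?_⟩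
  · have hwave m : KP3.localWave τ m ∈ KP3.adjWaveAnnihilator τ := by
      simpa only [pow_zero, one_mul] using h 0 m
    have heigen m : KP3.localEigenvalue ![n₁, n₂, n₃] * KP3.localWave τ m ∈
        KP3.adjWaveAnnihilator τ := by
      simpa only [pow_one] using h 1 m
    obtain ⟨L, hL⟩ := KP3.exists_isEigenOperator hτ _ hwave heigen
    exact ⟨(KP3.kpBilinear_iff hτ).2 hwave, L, (KP3.isEigenOperator_iff ![n₁, n₂, n₃] L).1 hL⟩
  · have hop : KP3.IsEigenOperator τ ![n₁, n₂, n₃] L :=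
      (KP3.isEigenOperator_iff ![n₁, n₂, n₃] L).2 hL
    exact hop.localEigenvalue_pow_mul_mem hτ ((KP3.kpBilinear_iff hτ).1 hkp)
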